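/- Let $K$ be a field of characteristic zero and let $\tilde E/K$ be a finite Galois extension with $\Gamma=\mathrm{Gal}(\tilde E/K)$. For a finite Galois extension $F/K$ with group $A=\mathrm{Gal}(F/K)$ and an $A$-group $N$ (a group on which $A$ acts by automorphisms, written $\ast$), let $A$ act on the group algebra $F[N]$ through Galois automorphisms on the coefficients and through $\ast$ on $N$; its fixed points $F[N]^A$ form a $K$-algebra. For a finite $\Gamma$-group $N$, write $\widehat N=\mathrm{Hom}(N,\tilde E^\times)$ for the set of characters of $N$, a $\Gamma$-set via $(\gamma\ast\chi)(\eta)=\gamma\bigl(\chi(\gamma^{-1}\ast\eta)\bigr)$. Two $\Gamma$-sets are isomorphic if there is a $\Gamma$-equivariant bijection between them. (1) Let $N_1,N_2$ be finite abelian $\Gamma$-groups, and suppose that $\tilde E$ contains a primitive $e$-th root of unity, where $e$ is the least common multiple of the exponents of $N_1$ and $N_2$. Then $\tilde E[N_1]^\Gamma\cong\tilde E[N_2]^\Gamma$ as $K$-algebras if and only if $\widehat{N_1}\cong\widehat{N_2}$ as $\Gamma$-sets. (2) Let $L/K$ be a finite extension with Galois closure $E$, let $G=\mathrm{Gal}(E/K)$,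 $G_L=\mathrm{Gal}(E/L)$, $X=G/G_L$ (left cosets), and let $\lambda:G\to\mathrm{Perm}(X)$ be the action by left translation. Let $N_1,N_2$ be regular subgroups of $\mathrm{Perm}(X)$ (of the same size as $X$ and transitive on $X$) that are stable under the action $\sigma\ast\eta=\lambda(\sigma)\eta\lambda(\sigma)^{-1}$ of $G$; by the theorem of Greither and Pareigis, the algebras $E[N]^G$ for such $N$ are exactly the underlying algebras of the Hopf algebras giving the Hopf–Galois structures on $L/K$. Suppose that $E[N_1]^G$ and $E[N_2]^G$ are commutative, that $\tilde E\supseteq E$, and that $\tilde E$ contains a primitive $e$-th root of unity, where $e$ is the least common multiple of the exponents of $N_1$ and $N_2$. Let $\Gamma$ act on $N_1,N_2$ through the restriction map $\Gamma\to G$. Then $E[N_1]^G\cong E[N_2]^G$ as $K$-algebras if and only if $\widehat{N_1}\cong\widehat{N_2}$ as $\Gamma$-sets. -/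

import Mathlib

/-- For a field extension `E/K` with `G = Gal(E/K)` and a `G`-group `N` (given by a homomorphism
`φ : G → Aut N`), the action of `g ∈ G` on the group algebra `E[N]`: Galois automorphism on the
coefficients, `φ g` on the group elements. -/
noncomputable def groupAlgebraAct {K E N : Type*} [Field K] [Field E] [Algebra K E] [Group N]
    (φ : Gal(E/K) →* MulAut N) (g : Gal(E/K)) :
    MonoidAlgebra E N →ₐ[K] MonoidAlgebra E N :=
  (MonoidAlgebra.mapDomainAlgHom K E (φ g).toMonoidHom).comp
    (MonoidAlgebra.mapAlgHom N (g : E →ₐ[K] E))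

theorem groupAlgebraAct_single {K E N : Type*} [Field K] [Field E] [Algebra K E] [Group N]
    (φ : Gal(E/K) →* MulAut N) (g : Gal(E/K)) (η : N) (a : E) :
    groupAlgebraAct φ g (MonoidAlgebra.single η a) = MonoidAlgebra.single (φ g η) (g a) := by
  simp [groupAlgebraAct]

/-- The fixed points `E[N]^G`, as a `K`-subalgebra of `E[N]`. -/
noncomputable def fixedAlgebra {K E N : Type*} [Field K] [Field E] [Algebra K E] [Group N]
    (φ : Gal(E/K) →* MulAut N) : Subalgebra K (MonoidAlgebra E N) :=
  ⨅ g : Gal(E/K), AlgHom.equalizer (groupAlgebraAct φ g) (AlgHom.id K (MonoidAlgebra E N))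

theorem mem_fixedAlgebra {K E N : Type*} [Field K] [Field E] [Algebra K E] [Group N]
    (φ : Gal(E/K) →* MulAut N) (x : MonoidAlgebra E N) :
    x ∈ fixedAlgebra φ ↔ ∀ g : Gal(E/K), groupAlgebraAct φ g x = x := by
  simp [fixedAlgebra, Algebra.mem_iInf]

/-- The action of `Gal(E/K)` on the characters `N → Eˣ`:
`(g ∗ χ)(η) = g (χ (g⁻¹ ∗ η))`. -/
def dualAct {K E N : Type*} [Field K] [Field E] [Algebra K E] [Group N]
    (φ : Gal(E/K) →* MulAut N) : Gal(E/K) →* Equiv.Perm (N →* Eˣ) :=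
  MonoidHom.toHomPerm
    { toFun := fun g χ =>
        ((Units.map (g : E →* E)).comp χ).comp (φ g⁻¹).toMonoidHom
      map_one' := by
        funext χ
        ext η
        simp
        rfl
      map_mul' := fun g h => by
        funext χ
        ext η
        simp
        rfl }

theorem dualAct_apply {K E N : Type*} [Field K] [Field E] [Algebra K E] [Group N]
    (φ : Gal(E/K) →* MulAut N) (g : Gal(E/K)) (χ : N →* Eˣ) (η : N) :
    ((dualAct φ g χ η : Eˣ) : E) = g ((χ (φ g⁻¹ η) : Eˣ) : E) := rfl

/-- Two `G`-sets, given by homomorphisms into permutation groups, are isomorphic if there is a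
`G`-equivariant bijection between them. -/
def IsomorphicGSets {G S T : Type*} [Group G]
    (a : G →* Equiv.Perm S) (b : G →* Equiv.Perm T) : Prop :=
  ∃ f : S ≃ T, ∀ (g : G) (s : S), f (a g s) = b g (f s)

/-- `G_L = Gal(E/L)` as a subgroup of `G = Gal(E/K)`, for a tower `K ⊆ L ⊆ E`. -/
def galSubgroup (K L E : Type*) [Field K] [Field L] [Field E] [Algebra K L] [Algebra K E]
    [Algebra L E] [IsScalarTower K L E] : Subgroup Gal(E/K) :=
  (IsScalarTower.toAlgHom K L E).fieldRange.fixingSubgroup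

/-- The left translation homomorphism `G → Perm X`, where `X = G / G_L`. -/
def leftTranslation (K L E : Type*) [Field K] [Field L] [Field E] [Algebra K L] [Algebra K E]
    [Algebra L E] [IsScalarTower K L E] :
    Gal(E/K) →* Equiv.Perm (Gal(E/K) ⧸ galSubgroup K L E) :=
  MulAction.toPermHom Gal(E/K) (Gal(E/K) ⧸ galSubgroup K L E)

/-- A regular subgroup of `Perm X`: it has the same size as `X` and acts transitively on `X`. -/
def IsRegularSubgroup {X : Type*} (N : Subgroup (Equiv.Perm X)) : Prop :=
  Nat.card N = Nat.card X ∧ ∀ x y : X, ∃ η ∈ N, η x = y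

/-- The subgroup `N` of `Perm X` is stable under `σ ∗ η = λ(σ) η λ(σ)⁻¹`, i.e. it is normalized
by the image of `G` under left translation. -/
def IsGStable {K L E : Type*} [Field K] [Field L] [Field E] [Algebra K L] [Algebra K E]
    [Algebra L E] [IsScalarTower K L E]
    (N : Subgroup (Equiv.Perm (Gal(E/K) ⧸ galSubgroup K L E))) : Prop :=
  ∀ σ : Gal(E/K), ∀ η ∈ N, leftTranslation K L E σ * η * (leftTranslation K L E σ)⁻¹ ∈ N

/-- The action `σ ∗ η = λ(σ) η λ(σ)⁻¹` of `G` on a `G`-stable subgroup `N` of `Perm X`. -/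
def conjAct {K L E : Type*} [Field K] [Field L] [Field E] [Algebra K L] [Algebra K E]
    [Algebra L E] [IsScalarTower K L E]
    {N : Subgroup (Equiv.Perm (Gal(E/K) ⧸ galSubgroup K L E))} (hN : IsGStable N) :
    Gal(E/K) →* MulAut N where
  toFun σ :=
    { toFun := fun η =>
        ⟨leftTranslation K L E σ * η * (leftTranslation K L E σ)⁻¹, hN σ η η.2⟩
      invFun := fun η =>
        ⟨leftTranslation K L E σ⁻¹ * η * (leftTranslation K L E σ⁻¹)⁻¹, hN σ⁻¹ η η.2⟩
      left_inv := fun η => by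
        apply Subtype.ext
        simp only [map_inv]
        group
      right_inv := fun η => by
        apply Subtype.ext
        simp only [map_inv]
        group
      map_mul' := fun η θ => by
        apply Subtype.ext
        simp only [Subgroup.coe_mul]
        group }
  map_one' := by
    ext1 η
    apply Subtype.ext
    simp
  map_mul' σ τ := by
    ext1 η
    apply Subtype.ext
    simp [mul_assoc]

theorem conjAct_coe {K L E : Type*} [Field K] [Field L] [Field E] [Algebra K L] [Algebra K E]
    [Algebra L E] [IsScalarTower K L E]
    {N : Subgroup (Equiv.Perm (Gal(E/K) ⧸ galSubgroup K L E))} (hN : IsGStable N)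
    (σ : Gal(E/K)) (η : N) :
    ((conjAct hN σ η : N) : Equiv.Perm (Gal(E/K) ⧸ galSubgroup K L E)) =
      leftTranslation K L E σ * η * (leftTranslation K L E σ)⁻¹ := rfl

/-!
By Galois descent, `E ⊗ E[N]^G ≅ E[N]`, whether or not `N` is abelian. Hence `N` is abelian as soon
as the fixed points commute, and the `K`-algebra homomorphisms from `E[N]^G` to an extension `M`
of `E` are the `E`-algebra homomorphisms `E[N] → M`, i.e. the characters `N → Mˣ`. So the
`Gal(M/K)`-set of characters is an invariant of the `K`-algebra `E[N]^G`.

Conversely, `E[N]^G ≅ M[N]^Γ` for `Γ = Gal(M/K)`, and when `M` has enough roots of unity the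
Fourier transform is an isomorphism from `M[N]` onto the functions from the set of characters
to `M`. It matches `M[N]^Γ` with the `Γ`-equivariant functions, which depend only on the `Γ`-set
of characters.
-/

section GaloisDescent

open Module TensorProduct

variable {K E : Type*} [Field K] [Field E] [Algebra K E]

theorem eq_of_forall_sum_mul_galois_apply_eq [Fintype Gal(E/K)] {v w : Gal(E/K) → E}
    (h : ∀ x, ∑ g, v g * g x = ∑ g, w g * g x) : v = w := by
  have independent : LinearIndependent E fun g : Gal(E/K) => (g : E →ₐ[K] E).toLinearMap :=
    (linearIndependent_toLinearMap K E E).comp _ AlgEquiv.coe_toAlgHom_injective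
  refine independent.fintypeLinearCombination_injective (LinearMap.ext fun x => ?_)
  simpa [Fintype.linearCombination_apply] using h x

variable [FiniteDimensional K E] [IsGalois K E] {ι : Type*} [Fintype ι] [DecidableEq ι]

theorem sum_trace_traceDual_mul_smul (b : Basis ι K E) (x : E) :
    ∑ i, Algebra.trace K E (b.traceDual i * x) • b i = x := by
  have coord (i : ι) : b.repr x i = Algebra.trace K E (b.traceDual i * x) := by
    rw [mul_comm, ← Algebra.traceForm_apply, ← b.traceDual.traceDual_repr_apply,
      b.traceDual_traceDual]
  simp_rw [← coord, b.sum_repr]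

theorem sum_mul_galois_traceDual [DecidableEq Gal(E/K)] (b : Basis ι K E) (g : Gal(E/K)) :
    ∑ i, b i * g (b.traceDual i) = if g = 1 then 1 else 0 := by
  refine congrFun (eq_of_forall_sum_mul_galois_apply_eq (w := fun g => if g = 1 then 1 else 0)
    (v := fun g : Gal(E/K) => ∑ i, b i * g (b.traceDual i)) fun x => ?_) g
  calc ∑ g : Gal(E/K), (∑ i, b i * g (b.traceDual i)) * g x
      = ∑ i, Algebra.trace K E (b.traceDual i * x) • b i := by
        simp only [Algebra.smul_def, trace_eq_sum_automorphisms, Finset.sum_mul, map_mul]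
        rw [Finset.sum_comm]
        exact Finset.sum_congr rfl fun i _ => Finset.sum_congr rfl fun g _ => by ring
    _ = ∑ g : Gal(E/K), (if g = 1 then 1 else 0) * g x := by
        simp [sum_trace_traceDual_mul_smul]

variable {V : Type*} [AddCommGroup V] [Module K V] [Module E V] [IsScalarTower K E V]

theorem isBaseChange_invariants (ρ : Representation K Gal(E/K) V)
    (hρ : ∀ g (c : E) v, ρ g (c • v) = g c • ρ g v) :
    IsBaseChange E ρ.invariants.subtype := by
  classical
  -- The inverse of `E ⊗ V^G → V` is `v ↦ ∑ i, b i ⊗ tr (bᵢ* • v)`, with `bᵢ*` the trace-dual basis.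
  let b := finBasis K E
  let trace : V →ₗ[K] ρ.invariants := ρ.norm.codRestrict _ fun v g => ρ.self_norm_apply g v
  let coords : V →ₗ[K] E ⊗[K] ρ.invariants :=
    ∑ i, TensorProduct.mk K E _ (b i) ∘ₗ trace ∘ₗ Algebra.lsmul K K V (b.traceDual i)
  let scale := ρ.invariants.subtype.liftBaseChange E
  have trace_smul (c : E) (w : ρ.invariants) : trace (c • (w : V)) = Algebra.trace K E c • w := by
    apply Subtype.ext
    simp only [trace, LinearMap.codRestrict_apply, Representation.norm, LinearMap.sum_apply, hρ,
      w.2 _, ← Finset.sum_smul, Submodule.coe_smul, ← trace_eq_sum_automorphisms, algebraMap_smul]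
  have scale_coords (v : V) : scale (coords v) = v := calc
    scale (coords v) = ∑ i, b i • ∑ g, g (b.traceDual i) • ρ g v := by
        simp [scale, coords, trace, Representation.norm, hρ]
    _ = ∑ g, (∑ i, b i * g (b.traceDual i)) • ρ g v := by
        simp only [Finset.smul_sum, Finset.sum_smul, mul_smul]
        exact Finset.sum_comm
    _ = v := by simp [sum_mul_galois_traceDual]
  have coords_scale : coords ∘ₗ scale.restrictScalars K = LinearMap.id :=
    TensorProduct.ext' fun c w => calc
      coords (scale (c ⊗ₜ w))
        = (∑ i, Algebra.trace K E (b.traceDual i * c) • b i) ⊗ₜ[K] w := by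
          simp only [scale, coords, LinearMap.liftBaseChange_tmul, Submodule.subtype_apply,
            LinearMap.sum_apply, LinearMap.comp_apply, Algebra.lsmul_coe, smul_smul, trace_smul,
            TensorProduct.mk_apply, TensorProduct.tmul_smul, TensorProduct.sum_tmul,
            TensorProduct.smul_tmul']
      _ = c ⊗ₜ w := by rw [sum_trace_traceDual_mul_smul]
  refine .of_equiv (.ofBijective scale ?_) fun w => ?_
  · exact Function.bijective_iff_has_inverse.2
      ⟨coords, LinearMap.congr_fun coords_scale, scale_coords⟩
  · simp [scale]

end GaloisDescent

section BaseChange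

variable {K E A B C : Type*} [CommSemiring K] [CommSemiring E] [Algebra K E]
  [Semiring A] [Algebra K A] [Semiring B] [Algebra K B] [Algebra E B] [IsScalarTower K E B]
  [Semiring C] [Algebra K C] [Algebra E C] [IsScalarTower K E C] {j : A →ₐ[K] B}

theorem mul_comm_of_isBaseChange (hj : IsBaseChange E j.toLinearMap)
    (hA : ∀ x y : A, x * y = y * x) (x y : B) : x * y = y * x := by
  have comm_j (a : A) (y : B) : j a * y = y * j a := by
    induction y using hj.inductionOn with
    | zero => simp
    | tmul b => simp [← map_mul, hA a b]
    | smul c y ih => simp [ih]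
    | add y z ihy ihz => simp [mul_add, add_mul, ihy, ihz]
  induction x using hj.inductionOn with
  | zero => simp
  | tmul a => exact comm_j a y
  | smul c x ih => simp [ih]
  | add x z ihx ihz => simp [mul_add, add_mul, ihx, ihz]

open TensorProduct in
theorem bijective_comp_of_isBaseChange (hj : IsBaseChange E j.toLinearMap) :
    Function.Bijective fun F : B →ₐ[E] C => (F.restrictScalars K).comp j := by
  let e : E ⊗[K] A ≃ₐ[E] B := .ofBijective (AlgHom.liftEquiv K E A B j) hj
  have e_symm (a : A) : e.symm (j a) = 1 ⊗ₜ a := by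
    have e_tmul : e (1 ⊗ₜ a) = AlgHom.liftEquiv K E A B j (1 ⊗ₜ a) := rfl
    simp [AlgEquiv.symm_apply_eq, e_tmul]
  refine ⟨fun F G h => ?_, fun f => ⟨(AlgHom.liftEquiv K E A C f).comp e.symm, ?_⟩⟩
  · exact AlgHom.toLinearMap_injective (hj.algHom_ext _ _ (DFunLike.congr_fun h))
  · ext a
    simp [e_symm]

end BaseChange

section GroupAlgebra

variable {K E N : Type*} [Field K] [Field E] [Algebra K E] [Group N]

/-- The semilinear action of `Gal(E/K)` on `E[N]`, as a representation over `K`. -/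
noncomputable def galoisRepresentation (φ : Gal(E/K) →* MulAut N) :
    Representation K Gal(E/K) (MonoidAlgebra E N) where
  toFun g := (groupAlgebraAct φ g).toLinearMap
  map_one' := by
    refine LinearMap.ext fun x => ?_
    induction x using MonoidAlgebra.induction_linear with
    | zero => simp
    | add x y hx hy => simp only [map_add, hx, hy]
    | single η a => simp [groupAlgebraAct_single]
  map_mul' g h := by
    refine LinearMap.ext fun x => ?_
    induction x using MonoidAlgebra.induction_linear with
    | zero => simp
    | add x y hx hy => simp only [map_add, hx, hy]
    | single η a => simp [groupAlgebraAct_single]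

theorem groupAlgebraAct_smul (φ : Gal(E/K) →* MulAut N) (g : Gal(E/K)) (c : E)
    (x : MonoidAlgebra E N) :
    groupAlgebraAct φ g (c • x) = g c • groupAlgebraAct φ g x := by
  induction x using MonoidAlgebra.induction_linear with
  | zero => simp
  | add x y hx hy => simp [hx, hy]
  | single η a => simp [groupAlgebraAct_single]

theorem coeff_groupAlgebraAct (φ : Gal(E/K) →* MulAut N) (g : Gal(E/K)) (x : MonoidAlgebra E N)
    (η : N) : (groupAlgebraAct φ g x).coeff (φ g η) = g (x.coeff η) := by
  classical
  induction x using MonoidAlgebra.induction_linear with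
  | zero => simp
  | add x y hx hy => simp [hx, hy]
  | single θ a => simp [groupAlgebraAct_single, Finsupp.single_apply, apply_ite g]

variable [FiniteDimensional K E] [IsGalois K E]

theorem isBaseChange_fixedAlgebra (φ : Gal(E/K) →* MulAut N) :
    IsBaseChange E (fixedAlgebra φ).val.toLinearMap := by
  have invariants_eq : (galoisRepresentation φ).invariants = (fixedAlgebra φ).toSubmodule := by
    ext x
    exact (mem_fixedAlgebra φ x).symm
  have := isBaseChange_invariants (galoisRepresentation φ) (groupAlgebraAct_smul φ)
  rw [invariants_eq] at this
  exact this

theorem mul_comm_of_fixedAlgebra_commute (φ : Gal(E/K) →* MulAut N)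
    (h : ∀ x y : fixedAlgebra φ, x * y = y * x) (η θ : N) : η * θ = θ * η := by
  apply MonoidAlgebra.of_injective (R := E)
  simp only [map_mul]
  exact mul_comm_of_isBaseChange (isBaseChange_fixedAlgebra φ) h _ _

end GroupAlgebra

section RestrictNormal

variable {K M : Type*} (E : Type*) [Field K] [Field E] [Field M] [Algebra K E] [Algebra K M]
  [Algebra E M] [IsScalarTower K E M] [Normal K E]

theorem restrictNormalHom_restrictScalars (δ : Gal(M/E)) :
    AlgEquiv.restrictNormalHom E (δ.restrictScalars K) = 1 := by
  ext a
  apply (algebraMap E M).injective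
  exact (AlgEquiv.restrictNormal_commutes (δ.restrictScalars K) E a).trans (δ.commutes a)

theorem restrictNormalHom_self :
    AlgEquiv.restrictNormalHom (F := K) (K₁ := E) E = MonoidHom.id Gal(E/K) :=
  MonoidHom.ext fun g => AlgEquiv.ext (AlgEquiv.restrictNormal_commutes g E)

end RestrictNormal

section ChangeOfField

variable {K E M N : Type*} [Field K] [Field E] [Field M] [Algebra K E] [Algebra K M]
  [Algebra E M] [IsScalarTower K E M] [Group N]

theorem groupAlgebraAct_comp_restrictNormalHom [Normal K E] (φ : Gal(E/K) →* MulAut N)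
    (γ : Gal(M/K)) (x : MonoidAlgebra E N) :
    groupAlgebraAct (φ.comp (AlgEquiv.restrictNormalHom E)) γ
        (MonoidAlgebra.mapAlgHom N (IsScalarTower.toAlgHom K E M) x) =
      MonoidAlgebra.mapAlgHom N (IsScalarTower.toAlgHom K E M)
        (groupAlgebraAct φ (AlgEquiv.restrictNormalHom E γ) x) := by
  induction x using MonoidAlgebra.induction_linear with
  | zero => simp
  | add x y hx hy => simp only [map_add, hx, hy]
  | single η a =>
    simp only [MonoidAlgebra.mapAlgHom_single, groupAlgebraAct_single]
    exact congrArg (MonoidAlgebra.single _) (AlgEquiv.restrictNormal_commutes γ E a).symm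

theorem mapAlgHom_toAlgHom_injective :
    Function.Injective (MonoidAlgebra.mapAlgHom N (IsScalarTower.toAlgHom K E M)) :=
  MonoidAlgebra.map_injective (f := (algebraMap E M).toAddMonoidHom) (algebraMap E M).injective

variable [Normal K E] [IsGalois K M]

variable (M) in
theorem map_fixedAlgebra (φ : Gal(E/K) →* MulAut N) :
    (fixedAlgebra φ).map (MonoidAlgebra.mapAlgHom N (IsScalarTower.toAlgHom K E M)) =
      fixedAlgebra (φ.comp (AlgEquiv.restrictNormalHom (K₁ := M) E)) := by
  have : IsGalois E M := .tower_top_of_isGalois K E M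
  ext y
  simp only [Subalgebra.mem_map, mem_fixedAlgebra]
  constructor
  · rintro ⟨x, hx, rfl⟩ γ
    rw [groupAlgebraAct_comp_restrictNormalHom, hx]
  · intro hy
    have coeff_mem (η : N) : y.coeff η ∈ Set.range (algebraMap E M) := by
      rw [InfiniteGalois.mem_range_algebraMap_iff_fixed]
      intro δ
      have h := coeff_groupAlgebraAct (φ.comp (AlgEquiv.restrictNormalHom E))
        (δ.restrictScalars K) y η
      rw [hy, MonoidHom.comp_apply, restrictNormalHom_restrictScalars] at h
      simpa using h.symm
    obtain ⟨x, rfl⟩ : y ∈ Set.range (MonoidAlgebra.mapAlgHom N (IsScalarTower.toAlgHom K E M)) :=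
      (MonoidAlgebra.range_map (algebraMap E M).toAddMonoidHom).ge coeff_mem
    refine ⟨x, fun g => mapAlgHom_toAlgHom_injective (K := K) (M := M) ?_, rfl⟩
    obtain ⟨γ, rfl⟩ := AlgEquiv.restrictNormalHom_surjective M g
    rw [← groupAlgebraAct_comp_restrictNormalHom, hy]

variable (M) in
/-- Enlarging the field does not change the fixed points: `E[N]^G ≅ M[N]^Γ`, where `Γ` acts
on `N` through restriction. -/
noncomputable def fixedAlgebraEquivOfTower (φ : Gal(E/K) →* MulAut N) :
    fixedAlgebra φ ≃ₐ[K] fixedAlgebra (φ.comp (AlgEquiv.restrictNormalHom (K₁ := M) E)) :=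
  ((fixedAlgebra φ).equivMapOfInjective _ mapAlgHom_toAlgHom_injective).trans
    (Subalgebra.equivOfEq _ _ (map_fixedAlgebra M φ))

end ChangeOfField

section Characters

variable {E M N : Type*} [CommSemiring E] [Semiring M] [Algebra E M] [Group N]

variable (E) in
/-- The algebra homomorphism `E[N] → M` that extends a character of `N` with values in an
`E`-algebra `M`. -/
noncomputable def charLift (χ : N →* Mˣ) : MonoidAlgebra E N →ₐ[E] M :=
  MonoidAlgebra.lift E M N ((Units.coeHom M).comp χ)

@[simp]
theorem charLift_single (χ : N →* Mˣ) (η : N) (a : E) :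
    charLift E χ (MonoidAlgebra.single η a) = a • (χ η : M) := by
  simp [charLift]

variable (E M N) in
theorem charLift_bijective :
    Function.Bijective (charLift E : (N →* Mˣ) → (MonoidAlgebra E N →ₐ[E] M)) := by
  refine (MonoidAlgebra.lift E M N).bijective.comp ⟨fun χ ψ h => ?_, fun f => ?_⟩
  · ext η
    exact DFunLike.congr_fun h η
  · exact ⟨f.toHomUnits, MonoidHom.ext fun η => rfl⟩

end Characters

section CharactersOfFixedPoints

variable {K E M N : Type*} [Field K] [Field E] [Field M] [Algebra K E] [Algebra K M]
  [Algebra E M] [IsScalarTower K E M] [Group N]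

theorem charLift_dualAct_groupAlgebraAct [Normal K E] (φ : Gal(E/K) →* MulAut N) (γ : Gal(M/K))
    (χ : N →* Mˣ) (x : MonoidAlgebra E N) :
    charLift E (dualAct (φ.comp (AlgEquiv.restrictNormalHom E)) γ χ)
        (groupAlgebraAct φ (AlgEquiv.restrictNormalHom E γ) x) = γ (charLift E χ x) := by
  induction x using MonoidAlgebra.induction_linear with
  | zero => simp
  | add x y hx hy => simp only [map_add, hx, hy]
  | single η a =>
    have restrict_apply :
        algebraMap E M (AlgEquiv.restrictNormalHom E γ a) = γ (algebraMap E M a) :=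
      AlgEquiv.restrictNormal_commutes γ E a
    simp [groupAlgebraAct_single, dualAct_apply, Algebra.smul_def, restrict_apply]

/-- The `K`-algebra homomorphism `E[N]^G → M` given by a character of `N`. -/
noncomputable def fixedEval (φ : Gal(E/K) →* MulAut N) (χ : N →* Mˣ) : fixedAlgebra φ →ₐ[K] M :=
  ((charLift E χ).restrictScalars K).comp (fixedAlgebra φ).val

theorem fixedEval_dualAct [Normal K E] (φ : Gal(E/K) →* MulAut N) (γ : Gal(M/K)) (χ : N →* Mˣ) :
    fixedEval φ (dualAct (φ.comp (AlgEquiv.restrictNormalHom E)) γ χ) =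
      (γ : M →ₐ[K] M).comp (fixedEval φ χ) := by
  ext x
  simpa [fixedEval, (mem_fixedAlgebra φ _).1 x.2] using
    charLift_dualAct_groupAlgebraAct φ γ χ (x : MonoidAlgebra E N)

theorem fixedEval_bijective [FiniteDimensional K E] [IsGalois K E] (φ : Gal(E/K) →* MulAut N) :
    Function.Bijective (fixedEval φ : (N →* Mˣ) → (fixedAlgebra φ →ₐ[K] M)) :=
  (bijective_comp_of_isBaseChange (isBaseChange_fixedAlgebra φ)).comp (charLift_bijective E M N)

theorem isomorphicGSets_dualAct_of_algEquiv [FiniteDimensional K E] [IsGalois K E]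
    {N₁ N₂ : Type*} [Group N₁] [Group N₂] {φ₁ : Gal(E/K) →* MulAut N₁}
    {φ₂ : Gal(E/K) →* MulAut N₂} (e : fixedAlgebra φ₁ ≃ₐ[K] fixedAlgebra φ₂) :
    IsomorphicGSets (dualAct (φ₁.comp (AlgEquiv.restrictNormalHom (K₁ := M) E)))
      (dualAct (φ₂.comp (AlgEquiv.restrictNormalHom (K₁ := M) E))) := by
  let points₁ := Equiv.ofBijective _ (fixedEval_bijective (M := M) φ₁)
  let points₂ := Equiv.ofBijective _ (fixedEval_bijective (M := M) φ₂)
  let f := (points₁.trans (e.arrowCongr AlgEquiv.refl)).trans points₂.symm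
  have fixedEval_f (χ : N₁ →* Mˣ) : fixedEval φ₂ (f χ) = (fixedEval φ₁ χ).comp e.symm :=
    points₂.apply_symm_apply _
  refine ⟨f, fun γ χ => (fixedEval_bijective φ₂).injective ?_⟩
  simp only [fixedEval_f, fixedEval_dualAct, AlgHom.comp_assoc]

end CharactersOfFixedPoints

section EquivariantFunctions

variable {K M : Type*} [Field K] [Field M] [Algebra K M] {S T : Type*}

/-- The `K`-algebra of `Gal(M/K)`-equivariant functions from a `Gal(M/K)`-set to `M`. -/
def equivariantFunctions (a : Gal(M/K) →* Equiv.Perm S) : Subalgebra K (S → M) where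
  carrier := {F | ∀ γ s, F (a γ s) = γ (F s)}
  mul_mem' hF hF' γ s := by simp [hF γ s, hF' γ s]
  add_mem' hF hF' γ s := by simp [hF γ s, hF' γ s]
  algebraMap_mem' c γ s := by simp

theorem comp_mem_equivariantFunctions_iff {a : Gal(M/K) →* Equiv.Perm S}
    {b : Gal(M/K) →* Equiv.Perm T} {f : S ≃ T} (hf : ∀ γ s, f (a γ s) = b γ (f s)) (F : T → M) :
    F ∘ f ∈ equivariantFunctions a ↔ F ∈ equivariantFunctions b := by
  refine forall_congr' fun γ => ?_
  rw [← f.forall_congr_right]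
  simp only [Function.comp_apply, hf]

theorem nonempty_algEquiv_equivariantFunctions_of_isomorphicGSets
    {a : Gal(M/K) →* Equiv.Perm S} {b : Gal(M/K) →* Equiv.Perm T} (h : IsomorphicGSets a b) :
    Nonempty (equivariantFunctions a ≃ₐ[K] equivariantFunctions b) := by
  obtain ⟨f, hf⟩ := h
  let pullback : (T → M) ≃ₐ[K] (S → M) := AlgEquiv.piCongrLeft' K (fun _ => M) f.symm
  have map_eq : (equivariantFunctions b).map (pullback : (T → M) →ₐ[K] (S → M)) =
      equivariantFunctions a := by
    ext F
    obtain ⟨F, rfl⟩ := pullback.surjective F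
    exact pullback.injective.mem_set_image.trans (comp_mem_equivariantFunctions_iff hf F).symm
  exact ⟨(((equivariantFunctions b).equivMapOfInjective _ pullback.injective).trans
    (Subalgebra.equivOfEq _ _ map_eq)).symm⟩

end EquivariantFunctions

section FourierTransform

/-- The Fourier transform: evaluation of elements of the group algebra at all characters. -/
noncomputable def charTransform (M N : Type*) [CommSemiring M] [Group N] :
    MonoidAlgebra M N →ₐ[M] ((N →* Mˣ) → M) :=
  AlgHom.pi (R := M) (charLift M)

@[simp]
theorem charTransform_apply {M N : Type*} [CommSemiring M] [Group N] (x : MonoidAlgebra M N)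
    (χ : N →* Mˣ) : charTransform M N x χ = charLift M χ x := rfl

variable {K M N : Type*} [Field K] [Field M] [Algebra K M] [CommGroup N] [Finite N]
  [HasEnoughRootsOfUnity M (Monoid.exponent N)]

theorem charTransform_injective : Function.Injective (charTransform M N) := by
  have independent : LinearIndependent M fun η : N => fun χ : N →* Mˣ => (χ η : M) :=
    (linearIndependent_monoidHom (N →* Mˣ) M).comp
      (fun η : N => (Units.coeHom M).comp (MonoidHom.eval η)) fun η θ h =>
        (CommGroup.forall_apply_eq_apply_iff N).1 fun χ => Units.ext (DFunLike.congr_fun h χ)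
  refine fun x y h => MonoidAlgebra.coeff_injective (independent ?_)
  funext χ
  simpa [charLift, MonoidAlgebra.lift_apply, Finsupp.linearCombination_apply, Finsupp.sum,
    Finset.sum_apply] using congrFun h χ

theorem charTransform_bijective : Function.Bijective (charTransform M N) := by
  have : Finite (N →* Mˣ) := .of_equiv N
    (CommGroup.monoidHom_mulEquiv_of_hasEnoughRootsOfUnity N M).some.symm
  have := Fintype.ofFinite (N →* Mˣ)
  have finrank_eq : Module.finrank M (MonoidAlgebra M N) = Module.finrank M ((N →* Mˣ) → M) := by
    rw [Module.finrank_eq_nat_card_basis (MonoidAlgebra.basis N M),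
      Module.finrank_fintype_fun_eq_card, ← Nat.card_eq_fintype_card,
      CommGroup.card_monoidHom_of_hasEnoughRootsOfUnity]
  have := Module.Finite.of_basis (MonoidAlgebra.basis N M)
  exact ⟨charTransform_injective, (LinearMap.injective_iff_surjective_of_finrank_eq_finrank
    finrank_eq (f := (charTransform M N).toLinearMap)).1 charTransform_injective⟩

theorem mem_fixedAlgebra_iff_charTransform_mem [Normal K M] (ψ : Gal(M/K) →* MulAut N)
    (x : MonoidAlgebra M N) :
    x ∈ fixedAlgebra ψ ↔ charTransform M N x ∈ equivariantFunctions (dualAct ψ) := by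
  have charLift_act (γ : Gal(M/K)) (χ : N →* Mˣ) :
      charLift M (dualAct ψ γ χ) (groupAlgebraAct ψ γ x) = γ (charLift M χ x) := by
    simpa [restrictNormalHom_self] using charLift_dualAct_groupAlgebraAct ψ γ χ x
  rw [mem_fixedAlgebra]
  refine forall_congr' fun γ => ?_
  rw [← charTransform_injective.eq_iff, funext_iff, ← (dualAct ψ γ).forall_congr_right]
  simp only [charTransform_apply, charLift_act, eq_comm]

theorem map_charTransform_fixedAlgebra [Normal K M] (ψ : Gal(M/K) →* MulAut N) :
    (fixedAlgebra ψ).map ((charTransform M N).restrictScalars K) =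
      equivariantFunctions (dualAct ψ) := by
  ext F
  obtain ⟨x, rfl⟩ := charTransform_bijective.surjective F
  rw [← mem_fixedAlgebra_iff_charTransform_mem]
  exact charTransform_injective.mem_set_image

/-- The Fourier transform, restricted to an isomorphism from `M[N]^Γ` onto the `Γ`-equivariant
functions on the characters of `N`. -/
noncomputable def fixedAlgebraEquivEquivariantFunctions [Normal K M] (ψ : Gal(M/K) →* MulAut N) :
    fixedAlgebra ψ ≃ₐ[K] equivariantFunctions (dualAct ψ) :=
  ((fixedAlgebra ψ).equivMapOfInjective _ charTransform_injective).trans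
    (Subalgebra.equivOfEq _ _ (map_charTransform_fixedAlgebra ψ))

end FourierTransform

theorem nonempty_algEquiv_of_isomorphicGSets_dualAct {K E M N₁ N₂ : Type*} [Field K] [Field E]
    [Field M] [Algebra K E] [Algebra K M] [Algebra E M] [IsScalarTower K E M] [Normal K E]
    [IsGalois K M] [CommGroup N₁] [Finite N₁] [HasEnoughRootsOfUnity M (Monoid.exponent N₁)]
    [CommGroup N₂] [Finite N₂] [HasEnoughRootsOfUnity M (Monoid.exponent N₂)]
    {φ₁ : Gal(E/K) →* MulAut N₁} {φ₂ : Gal(E/K) →* MulAut N₂}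
    (h : IsomorphicGSets (dualAct (φ₁.comp (AlgEquiv.restrictNormalHom (K₁ := M) E)))
      (dualAct (φ₂.comp (AlgEquiv.restrictNormalHom (K₁ := M) E)))) :
    Nonempty (fixedAlgebra φ₁ ≃ₐ[K] fixedAlgebra φ₂) := by
  obtain ⟨e⟩ := nonempty_algEquiv_equivariantFunctions_of_isomorphicGSets h
  let fourier₁ := (fixedAlgebraEquivOfTower M φ₁).trans (fixedAlgebraEquivEquivariantFunctions _)
  let fourier₂ := (fixedAlgebraEquivOfTower M φ₂).trans (fixedAlgebraEquivEquivariantFunctions _)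
  exact ⟨(fourier₁.trans e).trans fourier₂.symm⟩

theorem mainTheorem4_general {K E M N₁ N₂ : Type*} [Field K] [Field E] [Field M] [Algebra K E]
    [Algebra K M] [Algebra E M] [IsScalarTower K E M] [FiniteDimensional K E] [IsGalois K E]
    [IsGalois K M] [Group N₁] [Finite N₁] [Group N₂] [Finite N₂]
    (φ₁ : Gal(E/K) →* MulAut N₁) (φ₂ : Gal(E/K) →* MulAut N₂)
    (comm₁ : ∀ x y : fixedAlgebra φ₁, x * y = y * x)
    (comm₂ : ∀ x y : fixedAlgebra φ₂, x * y = y * x)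
    (hζ : ∃ ζ : M, IsPrimitiveRoot ζ (Nat.lcm (Monoid.exponent N₁) (Monoid.exponent N₂))) :
    Nonempty (fixedAlgebra φ₁ ≃ₐ[K] fixedAlgebra φ₂) ↔
      IsomorphicGSets (dualAct (φ₁.comp (AlgEquiv.restrictNormalHom (K₁ := M) E)))
        (dualAct (φ₂.comp (AlgEquiv.restrictNormalHom (K₁ := M) E))) := by
  let _ : CommGroup N₁ := { mul_comm := mul_comm_of_fixedAlgebra_commute φ₁ comm₁ }
  let _ : CommGroup N₂ := { mul_comm := mul_comm_of_fixedAlgebra_commute φ₂ comm₂ }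
  have : NeZero (Nat.lcm (Monoid.exponent N₁) (Monoid.exponent N₂)) :=
    ⟨Nat.lcm_ne_zero Monoid.exponent_ne_zero_of_finite Monoid.exponent_ne_zero_of_finite⟩
  have : HasEnoughRootsOfUnity M (Nat.lcm (Monoid.exponent N₁) (Monoid.exponent N₂)) :=
    ⟨hζ, inferInstance⟩
  have : HasEnoughRootsOfUnity M (Monoid.exponent N₁) :=
    .of_dvd M (Nat.dvd_lcm_left _ (Monoid.exponent N₂))
  have : HasEnoughRootsOfUnity M (Monoid.exponent N₂) :=
    .of_dvd M (Nat.dvd_lcm_right (Monoid.exponent N₁) _)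
  exact ⟨fun ⟨e⟩ => isomorphicGSets_dualAct_of_algEquiv e,
    nonempty_algEquiv_of_isomorphicGSets_dualAct⟩

theorem mainTheorem4 (K M : Type*) [Field K] [CharZero K]
    [Field M] [Algebra K M] [FiniteDimensional K M] [IsGalois K M] :
    -- `M` plays the role of `Ẽ`, and `Γ = Gal(M/K)`.
    -- Abelian `Γ`-groups `N₁`, `N₂`.
    (∀ (N₁ : Type*) (N₂ : Type*) [CommGroup N₁] [Finite N₁] [CommGroup N₂] [Finite N₂]
        (φ₁ : Gal(M/K) →* MulAut N₁) (φ₂ : Gal(M/K) →* MulAut N₂),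
      (∃ ζ : M, IsPrimitiveRoot ζ (Nat.lcm (Monoid.exponent N₁) (Monoid.exponent N₂))) →
      (Nonempty (fixedAlgebra φ₁ ≃ₐ[K] fixedAlgebra φ₂) ↔
        IsomorphicGSets (dualAct φ₁) (dualAct φ₂))) ∧
    -- Commutative Hopf-Galois structures on `L/K`; `E` is the Galois closure of `L/K`, and `Γ`
    -- acts on `Nᵢ` through the restriction map `Γ → G = Gal(E/K)`.
    (∀ (L : Type*) (E : Type*) [Field L] [Field E] [Algebra K L] [Algebra K E] [Algebra L E]
        [IsScalarTower K L E] [FiniteDimensional K L] [IsGalois K E] [IsNormalClosure K L E]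
        [Algebra E M] [IsScalarTower K E M]
        (N₁ N₂ : Subgroup (Equiv.Perm (Gal(E/K) ⧸ galSubgroup K L E)))
        (_ : IsRegularSubgroup N₁) (_ : IsRegularSubgroup N₂)
        (h₁ : IsGStable N₁) (h₂ : IsGStable N₂),
      (∀ x y : fixedAlgebra (conjAct h₁), x * y = y * x) →
      (∀ x y : fixedAlgebra (conjAct h₂), x * y = y * x) →
      (∃ ζ : M, IsPrimitiveRoot ζ (Nat.lcm (Monoid.exponent N₁) (Monoid.exponent N₂))) →
      (Nonempty (fixedAlgebra (conjAct h₁) ≃ₐ[K] fixedAlgebra (conjAct h₂)) ↔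
        IsomorphicGSets
          (dualAct ((conjAct h₁).comp (AlgEquiv.restrictNormalHom (K₁ := M) E)))
          (dualAct ((conjAct h₂).comp (AlgEquiv.restrictNormalHom (K₁ := M) E))))) := by
  refine ⟨fun N₁ N₂ _ _ _ _ φ₁ φ₂ hζ => ?_, fun L E _ _ _ _ _ _ _ _ _ _ _ N₁ N₂ _ _ h₁ h₂ => ?_⟩
  · simpa only [restrictNormalHom_self, MonoidHom.comp_id] using
      mainTheorem4_general φ₁ φ₂ mul_comm mul_comm hζ
  · have : FiniteDimensional K E := .left K E M
    exact mainTheorem4_general (conjAct h₁) (conjAct h₂)
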